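/- **Setting.** For $0<p<1$ let $\theta_1(z)=2p^{1/4}\sin z\prod_{n\ge1}(1-p^{2n})(1-2p^{2n}\cos 2z+p^{4n})$, $\theta_2(z)=2p^{1/4}\cos z\prod_{n\ge1}(1-p^{2n})(1+2p^{2n}\cos 2z+p^{4n})$, $\theta_3(z)=\prod_{n\ge1}(1-p^{2n})(1+2p^{2n-1}\cos 2z+p^{4n-2})$, $\theta_4(z)=\prod_{n\ge1}(1-p^{2n})(1-2p^{2n-1}\cos 2z+p^{4n-2})$ be the Jacobi theta functions of nome $p$. Let $M\in\{0,1,2,\dots\}$ and let $u_1,\dots,u_4,v_1,\dots,v_4,u$ be real with $u_r>0$ and $|v_r|<u_r+\tfrac12$ for $r=1,2$. Put $\alpha=\pi/(u_1+u_2+M)$, suppose that $u,u+1\notin\frac{2\pi}{\alpha}\mathbb Z$, and set $$[z]_1=\frac{\theta_1(\frac\alpha2z)}{\frac\alpha2\theta_1'(0)},\qquad [z]_r=\frac{\theta_r(\frac\alpha2z)}{\theta_r(0)}\quad(r=2,3,4).$$ Let $\pi_1=\mathrm{id}$, $\pi_2=(12)(34)$, $\pi_3=(13)(24)$, $\pi_4=(14)(23)$,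 and $$A(z)=\prod_{r=1}^4\frac{[z+u_r]_r}{[z]_r}\frac{[z+\frac12+v_r]_r}{[z+\frac12]_r},\qquad B(z)=\sum_{r=1}^4c_r\frac{[z+\frac12+u]_r}{[z+\frac12]_r}\frac{[z-\frac12-u]_r}{[z-\frac12]_r},\qquad c_r=\frac{2}{[u]_1[u+1]_1}\prod_{s=1}^4[u_{\pi_r(s)}-\tfrac12]_s[v_{\pi_r(s)}]_s,$$ where a term of $B$ with $c_r=0$ is zero. Put $a_k=A(-u_1-k)$ and $\tilde a_k=A(u_1+M-k)$ for $1\le k\le M$, and $b_k=B(u_1+k)$ for $0\le k\le M$. Let $\mathbf H$ be the real tridiagonal $(M+1)\times(M+1)$ matrix, with rows and columns numbered $0,\dots,M$, whose only nonzero entries can be $\mathbf H_{k,k}=b_k$, $\mathbf H_{k,k-1}=a_k$ and $\mathbf H_{k,k+1}=\tilde a_{M-k}$. For $0\le k\le M+1$ let $p_k(E)$ be the determinant of the leading $k\times k$ block of $E\,\mathbf I-\mathbf H$ (so $p_0=1$). The normalized elliptic Racah polynomials and the weights are $$f_k(E)=p_k(E)\prod_{0\le j<k}\tilde a_{M-j}^{-1},\qquad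 \Delta_k=\prod_{1\le l\le k}\frac{\tilde a_{M+1-l}}{a_l}\qquad(0\le k\le M).$$ Let $\tilde p_M$ be the polynomial $p_M$ for the permuted parameters $(u_1,v_1)\leftrightarrow(u_2,v_2)$, $(u_3,v_3)\leftrightarrow(u_4,v_4)$. **Proposition (Orthogonality Relation).** The numbers $a_1,\dots,a_M,\tilde a_1,\dots,\tilde a_M$ are positive, and the spectrum of $\mathbf H$ consists of $M+1$ distinct real eigenvalues $E_0>E_1>\dots>E_M$. The numbers $\epsilon_j=\tilde p_M(E_j)/(a_1\cdots a_M)$ are nonzero, and for $0\le i,j\le M$ $$\sum_{k=0}^M f_k(E_i)f_k(E_j)\Delta_k=\begin{cases}N_j&\text{if } i=j,\\0&\text{if } i\ne j,\end{cases}$$ with $$N_j=\frac1{|\epsilon_j|\,a_1\cdots a_M}\prod_{\substack{0\le l\le M\\ l\ne j}}|E_j-E_l| =\frac1{|\epsilon_j|}\prod_{\substack{1\le k\le M\\1\le r\le4}}\frac{[u_1+k]_r}{[u_1-u_r+k]_r}\frac{[u_1-\frac12+k]_r}{[u_1-v_r-\frac12+k]_r}\prod_{\substack{0\le l\le M\\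 l\ne j}}|E_j-E_l| .$$ -/

import Mathlib

open scoped BigOperators

namespace EllipticRacah

noncomputable section

/-! Throughout, the index set `{1, 2, 3, 4}` is `Fin 4`, so the index `r` becomes `r - 1`. -/

/-- The Jacobi theta function `θ₁(z; p)` with nome `p`, for real arguments. -/
def theta1 (p z : ℝ) : ℝ :=
  2 * p ^ (1 / 4 : ℝ) * Real.sin z *
    ∏' n : ℕ, (1 - p ^ (2 * (n + 1))) *
      (1 - 2 * p ^ (2 * (n + 1)) * Real.cos (2 * z) + p ^ (4 * (n + 1)))

/-- The Jacobi theta function `θ₂(z; p)` with nome `p`, for real arguments. -/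
def theta2 (p z : ℝ) : ℝ :=
  2 * p ^ (1 / 4 : ℝ) * Real.cos z *
    ∏' n : ℕ, (1 - p ^ (2 * (n + 1))) *
      (1 + 2 * p ^ (2 * (n + 1)) * Real.cos (2 * z) + p ^ (4 * (n + 1)))

/-- The Jacobi theta function `θ₃(z; p)` with nome `p`, for real arguments. -/
def theta3 (p z : ℝ) : ℝ :=
  ∏' n : ℕ, (1 - p ^ (2 * (n + 1))) *
    (1 + 2 * p ^ (2 * n + 1) * Real.cos (2 * z) + p ^ (4 * n + 2))

/-- The Jacobi theta function `θ₄(z; p)` with nome `p`, for real arguments. -/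
def theta4 (p z : ℝ) : ℝ :=
  ∏' n : ℕ, (1 - p ^ (2 * (n + 1))) *
    (1 - 2 * p ^ (2 * n + 1) * Real.cos (2 * z) + p ^ (4 * n + 2))

/-- The permutations `π₁ = id`, `π₂ = (12)(34)`, `π₃ = (13)(24)`, `π₄ = (14)(23)`. -/
def perm : Fin 4 → Equiv.Perm (Fin 4) :=
  ![1, Equiv.swap 0 1 * Equiv.swap 2 3, Equiv.swap 0 2 * Equiv.swap 1 3,
    Equiv.swap 0 3 * Equiv.swap 1 2]

/-- The free parameters: the size `M`, the elliptic nome `p`, the coupling parameters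
`u₁, …, u₄` and `v₁, …, v₄`, and the virtual regularization parameter (called `w` here). -/
structure Parameters where
  M : ℕ
  p : ℝ
  u : Fin 4 → ℝ
  v : Fin 4 → ℝ
  w : ℝ

namespace Parameters

variable (P : Parameters)

/-- The scaling parameter `α = π / (u₁ + u₂ + M)`. -/
def alpha : ℝ := Real.pi / (P.u 0 + P.u 1 + P.M)

/-- The rescaled theta functions `[z]_r`. -/
def bracket (r : Fin 4) (z : ℝ) : ℝ :=
  ![theta1 P.p (P.alpha / 2 * z) / (P.alpha / 2 * deriv (theta1 P.p) 0),
    theta2 P.p (P.alpha / 2 * z) / theta2 P.p 0,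
    theta3 P.p (P.alpha / 2 * z) / theta3 P.p 0,
    theta4 P.p (P.alpha / 2 * z) / theta4 P.p 0] r

/-- The coefficient function `A(z)` of the difference Heun operator. -/
def coeffA (z : ℝ) : ℝ :=
  ∏ r : Fin 4, P.bracket r (z + P.u r) / P.bracket r z *
    (P.bracket r (z + 1 / 2 + P.v r) / P.bracket r (z + 1 / 2))

/-- The constants `c_r`. -/
def coeffC (r : Fin 4) : ℝ :=
  2 / (P.bracket 0 P.w * P.bracket 0 (P.w + 1)) *
    ∏ s : Fin 4, P.bracket s (P.u (perm r s) - 1 / 2) * P.bracket s (P.v (perm r s))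

/-- The coefficient function `B(z)` of the difference Heun operator. -/
def coeffB (z : ℝ) : ℝ :=
  ∑ r : Fin 4, P.coeffC r *
    (P.bracket r (z + 1 / 2 + P.w) / P.bracket r (z + 1 / 2)) *
    (P.bracket r (z - 1 / 2 - P.w) / P.bracket r (z - 1 / 2))

/-- `a_k = A(-u₁ - k)`. -/
def a (k : ℕ) : ℝ := P.coeffA (-P.u 0 - k)

/-- `ã_k = A(u₁ + M - k)`. -/
def aTilde (k : ℕ) : ℝ := P.coeffA (P.u 0 + P.M - k)

/-- `b_k = B(u₁ + k)`. -/
def b (k : ℕ) : ℝ := P.coeffB (P.u 0 + k)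

/-- The leading `n × n` block (`n ≤ M + 1`) of the tridiagonal matrix `H`: for rows and columns
numbered from `0`, row `i` holds `a_i`, `b_i`, `ã_{M-i}` in columns `i - 1`, `i`, `i + 1`. -/
def heunBlock (n : ℕ) : Matrix (Fin n) (Fin n) ℝ :=
  Matrix.of fun i j =>
    if (i : ℕ) = j then P.b i
    else if (i : ℕ) = j + 1 then P.a i
    else if (j : ℕ) = i + 1 then P.aTilde (P.M - i)
    else 0

/-- The `(M + 1) × (M + 1)` tridiagonal matrix `H`. -/
def heunMatrix : Matrix (Fin (P.M + 1)) (Fin (P.M + 1)) ℝ := P.heunBlock (P.M + 1)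

/-- The monic elliptic Racah polynomial `p_k`, `0 ≤ k ≤ M + 1`: the determinant of the leading
`k × k` block of `X - H`. -/
def racahPoly (k : ℕ) : Polynomial ℝ := (P.heunBlock k).charpoly

/-- The normalized elliptic Racah polynomial `f_k(x) = p_k(x) ∏_{0 ≤ j < k} ã_{M-j}⁻¹`. -/
def f (k : ℕ) (x : ℝ) : ℝ :=
  (P.racahPoly k).eval x * ∏ j ∈ Finset.range k, (P.aTilde (P.M - j))⁻¹

/-- The weights `Δ_k = ∏_{1 ≤ l ≤ k} ã_{M+1-l} / a_l`. -/
def weight (k : ℕ) : ℝ := ∏ l ∈ Finset.Icc 1 k, P.aTilde (P.M + 1 - l) / P.a l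

/-- The action of `π₂` on the coupling parameters:
`(u₁, v₁) ↔ (u₂, v₂)` and `(u₃, v₃) ↔ (u₄, v₄)`. -/
def swap : Parameters := { P with u := P.u ∘ perm 1, v := P.v ∘ perm 1 }

/-- `ε = p̃_M(x) / (a_1 ⋯ a_M)`, where `p̃_M` is `p_M` for the parameters permuted by `π₂`;
at `x = E_j` this is `ε_j`. -/
def eps (x : ℝ) : ℝ := (P.swap.racahPoly P.M).eval x / ∏ k ∈ Finset.Icc 1 P.M, P.a k

end Parameters

end

end EllipticRacah

namespace EllipticRacah

/-- The infinite product common to the four theta functions. -/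
noncomputable def thetaProduct (r q : ℕ → ℝ) (t : ℝ) : ℝ :=
  ∏' n, (1 - r n) * (1 + 2 * q n * t + q n ^ 2)

section ThetaProduct

variable {r q : ℕ → ℝ}

lemma thetaFactor_bounds {q t : ℝ} (hq0 : 0 ≤ q) (ht : |t| ≤ 1) :
    (1 - q) ^ 2 ≤ 1 + 2 * q * t + q ^ 2 ∧ 1 + 2 * q * t + q ^ 2 ≤ (1 + q) ^ 2 := by
  obtain ⟨h1, h2⟩ := abs_le.mp ht
  constructor <;> nlinarith

lemma thetaFactor_pos {r q t : ℝ} (hr1 : r < 1) (hq0 : 0 ≤ q) (hq1 : q < 1) (ht : |t| ≤ 1) :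
    0 < (1 - r) * (1 + 2 * q * t + q ^ 2) := by
  have h1 : 0 < (1 - q) ^ 2 := by have : 0 < 1 - q := by linarith
                                  positivity
  exact mul_pos (by linarith) (h1.trans_le (thetaFactor_bounds hq0 ht).1)

lemma abs_log_thetaFactor_le {r q t : ℝ} (hr0 : 0 ≤ r) (hr1 : r < 1) (hq0 : 0 ≤ q) (hq1 : q < 1)
    (ht : |t| ≤ 1) :
    |Real.log ((1 - r) * (1 + 2 * q * t + q ^ 2))| ≤
      -Real.log (1 + -r) + 2 * -Real.log (1 + -q) := by
  obtain ⟨h1, h2⟩ := thetaFactor_bounds hq0 ht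
  have hq : 0 < 1 - q := by linarith
  have h0 : 0 < 1 + 2 * q * t + q ^ 2 := lt_of_lt_of_le (by positivity) h1
  have hr : Real.log (1 - r) ≤ 0 := Real.log_nonpos (by linarith) (by linarith)
  have hl1 := Real.log_le_log (by positivity) h1
  have hl2 := Real.log_le_log h0 h2
  have hl3 : Real.log (1 + q) + Real.log (1 - q) ≤ 0 := by
    rw [← Real.log_mul (by positivity) hq.ne']
    exact Real.log_nonpos (by nlinarith) (by nlinarith)
  rw [Real.log_pow] at hl1 hl2
  push_cast at hl1 hl2
  rw [Real.log_mul (by linarith) h0.ne', ← sub_eq_add_neg, ← sub_eq_add_neg, abs_le]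
  constructor <;> linarith

lemma summable_logBound (hr : Summable r) (hq : Summable q) :
    Summable fun n => -Real.log (1 + -r n) + 2 * -Real.log (1 + -q n) :=
  (Real.summable_log_one_add_of_summable hr.neg).neg.add
    ((Real.summable_log_one_add_of_summable hq.neg).neg.mul_left 2)

lemma thetaProduct_eq_exp (hr : ∀ n, r n ∈ Set.Ico 0 1) (hq : ∀ n, q n ∈ Set.Ico 0 1)
    (hrs : Summable r) (hqs : Summable q) {t : ℝ} (ht : |t| ≤ 1) :
    thetaProduct r q t =
      Real.exp (∑' n, Real.log ((1 - r n) * (1 + 2 * q n * t + q n ^ 2))) :=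
  (Real.rexp_tsum_eq_tprod (fun n => thetaFactor_pos (hr n).2 (hq n).1 (hq n).2 ht)
    ((summable_logBound hrs hqs).of_norm_bounded fun n =>
      abs_log_thetaFactor_le (hr n).1 (hr n).2 (hq n).1 (hq n).2 ht)).symm

lemma thetaProduct_pos (hr : ∀ n, r n ∈ Set.Ico 0 1) (hq : ∀ n, q n ∈ Set.Ico 0 1)
    (hrs : Summable r) (hqs : Summable q) {t : ℝ} (ht : |t| ≤ 1) : 0 < thetaProduct r q t := by
  rw [thetaProduct_eq_exp hr hq hrs hqs ht]
  exact Real.exp_pos _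

lemma continuous_thetaProduct_comp (hr : ∀ n, r n ∈ Set.Ico 0 1) (hq : ∀ n, q n ∈ Set.Ico 0 1)
    (hrs : Summable r) (hqs : Summable q) {g : ℝ → ℝ} (hg : Continuous g) (hg1 : ∀ x, |g x| ≤ 1) :
    Continuous fun x => thetaProduct r q (g x) := by
  have h : (fun x => thetaProduct r q (g x)) = fun x =>
      Real.exp (∑' n, Real.log ((1 - r n) * (1 + 2 * q n * g x + q n ^ 2))) :=
    funext fun x => thetaProduct_eq_exp hr hq hrs hqs (hg1 x)
  rw [h]
  refine Real.continuous_exp.comp (continuous_tsum (fun n => ?_) (summable_logBound hrs hqs)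
    fun n x => abs_log_thetaFactor_le (hr n).1 (hr n).2 (hq n).1 (hq n).2 (hg1 x))
  exact Continuous.log (by fun_prop) fun x =>
    (thetaFactor_pos (hr n).2 (hq n).1 (hq n).2 (hg1 x)).ne'

end ThetaProduct

section Theta

variable {p : ℝ}

lemma pow_mem_Ico (hp0 : 0 < p) (hp1 : p < 1) {n : ℕ} (hn : n ≠ 0) :
    p ^ n ∈ Set.Ico (0 : ℝ) 1 :=
  ⟨by positivity, pow_lt_one₀ hp0.le hp1 hn⟩

lemma summable_pow_comp (hp0 : 0 < p) (hp1 : p < 1) {e : ℕ → ℕ} (he : ∀ n, n ≤ e n) :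
    Summable fun n => p ^ e n :=
  (summable_geometric_of_lt_one hp0.le hp1).of_nonneg_of_le (fun n => by positivity)
    fun n => pow_le_pow_of_le_one hp0.le hp1.le (he n)

/-- The product `∏ (1 - p^(2n)) (1 + 2 p^(2n) t + p^(4n))`, `n ≥ 1`. -/
noncomputable def evenProduct (p t : ℝ) : ℝ :=
  thetaProduct (fun n => p ^ (2 * (n + 1))) (fun n => p ^ (2 * (n + 1))) t

/-- The product `∏ (1 - p^(2n)) (1 + 2 p^(2n-1) t + p^(4n-2))`, `n ≥ 1`. -/
noncomputable def oddProduct (p t : ℝ) : ℝ :=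
  thetaProduct (fun n => p ^ (2 * (n + 1))) (fun n => p ^ (2 * n + 1)) t

lemma evenProduct_pos (hp0 : 0 < p) (hp1 : p < 1) {t : ℝ} (ht : |t| ≤ 1) :
    0 < evenProduct p t :=
  thetaProduct_pos (fun n => pow_mem_Ico hp0 hp1 (by lia)) (fun n => pow_mem_Ico hp0 hp1 (by lia))
    (summable_pow_comp hp0 hp1 fun n => by lia) (summable_pow_comp hp0 hp1 fun n => by lia) ht

lemma oddProduct_pos (hp0 : 0 < p) (hp1 : p < 1) {t : ℝ} (ht : |t| ≤ 1) :
    0 < oddProduct p t :=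
  thetaProduct_pos (fun n => pow_mem_Ico hp0 hp1 (by lia)) (fun n => pow_mem_Ico hp0 hp1 (by lia))
    (summable_pow_comp hp0 hp1 fun n => by lia) (summable_pow_comp hp0 hp1 fun n => by lia) ht

lemma continuous_evenProduct_comp (hp0 : 0 < p) (hp1 : p < 1) {g : ℝ → ℝ} (hg : Continuous g)
    (hg1 : ∀ x, |g x| ≤ 1) : Continuous fun x => evenProduct p (g x) :=
  continuous_thetaProduct_comp (fun n => pow_mem_Ico hp0 hp1 (by lia))
    (fun n => pow_mem_Ico hp0 hp1 (by lia)) (summable_pow_comp hp0 hp1 fun n => by lia)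
    (summable_pow_comp hp0 hp1 fun n => by lia) hg hg1

lemma theta1_eq (p z : ℝ) : theta1 p z =
    2 * p ^ (1 / 4 : ℝ) * Real.sin z * evenProduct p (-Real.cos (2 * z)) := by
  unfold theta1 evenProduct thetaProduct
  congr 1
  exact tprod_congr fun n => by ring

lemma theta2_eq (p z : ℝ) : theta2 p z =
    2 * p ^ (1 / 4 : ℝ) * Real.cos z * evenProduct p (Real.cos (2 * z)) := by
  unfold theta2 evenProduct thetaProduct
  congr 1
  exact tprod_congr fun n => by ring

lemma theta3_eq (p z : ℝ) : theta3 p z = oddProduct p (Real.cos (2 * z)) := by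
  unfold theta3 oddProduct thetaProduct
  exact tprod_congr fun n => by ring

lemma theta4_eq (p z : ℝ) : theta4 p z = oddProduct p (-Real.cos (2 * z)) := by
  unfold theta4 oddProduct thetaProduct
  exact tprod_congr fun n => by ring

lemma cos_two_mul_add_pi_div_two (z : ℝ) :
    Real.cos (2 * (z + Real.pi / 2)) = -Real.cos (2 * z) := by
  rw [show 2 * (z + Real.pi / 2) = 2 * z + Real.pi by ring, Real.cos_add_pi]

lemma theta1_add_pi_div_two (p z : ℝ) : theta1 p (z + Real.pi / 2) = theta2 p z := by
  rw [theta1_eq, theta2_eq, cos_two_mul_add_pi_div_two, Real.sin_add_pi_div_two, neg_neg]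

lemma theta2_add_pi_div_two (p z : ℝ) : theta2 p (z + Real.pi / 2) = -theta1 p z := by
  rw [theta1_eq, theta2_eq, cos_two_mul_add_pi_div_two, Real.cos_add_pi_div_two]
  ring

lemma theta3_add_pi_div_two (p z : ℝ) : theta3 p (z + Real.pi / 2) = theta4 p z := by
  rw [theta3_eq, theta4_eq, cos_two_mul_add_pi_div_two]

lemma theta4_add_pi_div_two (p z : ℝ) : theta4 p (z + Real.pi / 2) = theta3 p z := by
  rw [theta3_eq, theta4_eq, cos_two_mul_add_pi_div_two, neg_neg]

lemma theta1_neg (p z : ℝ) : theta1 p (-z) = -theta1 p z := by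
  simp [theta1]

lemma theta2_neg (p z : ℝ) : theta2 p (-z) = theta2 p z := by
  simp [theta2]

lemma theta3_neg (p z : ℝ) : theta3 p (-z) = theta3 p z := by
  simp [theta3]

lemma theta4_neg (p z : ℝ) : theta4 p (-z) = theta4 p z := by
  simp [theta4]

lemma abs_neg_cos_le_one (x : ℝ) : |-Real.cos x| ≤ 1 := by
  rw [abs_neg]
  exact Real.abs_cos_le_one x

lemma theta1_pos (hp0 : 0 < p) (hp1 : p < 1) {z : ℝ} (h0 : 0 < z) (h1 : z < Real.pi) :
    0 < theta1 p z := by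
  have := Real.sin_pos_of_pos_of_lt_pi h0 h1
  have := evenProduct_pos hp0 hp1 (abs_neg_cos_le_one (2 * z))
  rw [theta1_eq]
  positivity

lemma theta2_pos (hp0 : 0 < p) (hp1 : p < 1) {z : ℝ} (h0 : -(Real.pi / 2) < z)
    (h1 : z < Real.pi / 2) : 0 < theta2 p z := by
  have := Real.cos_pos_of_mem_Ioo ⟨h0, h1⟩
  have := evenProduct_pos hp0 hp1 (Real.abs_cos_le_one (2 * z))
  rw [theta2_eq]
  positivity

lemma theta3_pos (hp0 : 0 < p) (hp1 : p < 1) (z : ℝ) : 0 < theta3 p z := by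
  rw [theta3_eq]
  exact oddProduct_pos hp0 hp1 (Real.abs_cos_le_one _)

lemma theta4_pos (hp0 : 0 < p) (hp1 : p < 1) (z : ℝ) : 0 < theta4 p z := by
  rw [theta4_eq]
  exact oddProduct_pos hp0 hp1 (abs_neg_cos_le_one _)

lemma hasDerivAt_mul_of_continuousAt {f g : ℝ → ℝ} {f' a : ℝ} (hf : HasDerivAt f f' a)
    (h0 : f a = 0) (hg : ContinuousAt g a) : HasDerivAt (fun x => f x * g x) (f' * g a) a := by
  rw [hasDerivAt_iff_tendsto_slope] at hf ⊢
  refine (hf.mul (hg.tendsto.mono_left nhdsWithin_le_nhds)).congr fun x => ?_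
  simp only [slope_def_field, h0]
  ring

lemma deriv_theta1_zero_pos (hp0 : 0 < p) (hp1 : p < 1) : 0 < deriv (theta1 p) 0 := by
  have hc : Continuous fun z => 2 * p ^ (1 / 4 : ℝ) * evenProduct p (-Real.cos (2 * z)) :=
    continuous_const.mul (continuous_evenProduct_comp hp0 hp1 (by fun_prop)
      fun z => abs_neg_cos_le_one _)
  have h := hasDerivAt_mul_of_continuousAt (Real.hasDerivAt_sin 0) Real.sin_zero
    hc.continuousAt
  have he : theta1 p = fun z =>
      Real.sin z * (2 * p ^ (1 / 4 : ℝ) * evenProduct p (-Real.cos (2 * z))) :=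
    funext fun z => by rw [theta1_eq]; ring
  rw [he, h.deriv, Real.cos_zero]
  have := evenProduct_pos hp0 hp1 (abs_neg_cos_le_one (2 * 0))
  positivity

end Theta

/-- The four theta functions, as a family. -/
noncomputable def theta (p : ℝ) (r : Fin 4) (z : ℝ) : ℝ :=
  ![theta1 p z, theta2 p z, theta3 p z, theta4 p z] r

lemma theta_div_theta_add_pi_div_two (p x y : ℝ) (r : Fin 4) :
    theta p r (x + Real.pi / 2) / theta p r (y + Real.pi / 2) =
      theta p (perm 1 r) x / theta p (perm 1 r) y := by
  have h0 : perm 1 0 = 1 := by decide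
  have h1 : perm 1 1 = 0 := by decide
  have h2 : perm 1 2 = 3 := by decide
  have h3 : perm 1 3 = 2 := by decide
  fin_cases r <;> simp [h0, h1, h2, h3, theta, theta1_add_pi_div_two, theta2_add_pi_div_two,
    theta3_add_pi_div_two, theta4_add_pi_div_two, neg_div_neg_eq]

lemma theta_div_theta_neg (p x y : ℝ) (r : Fin 4) :
    theta p r (-x) / theta p r (-y) = theta p r x / theta p r y := by
  fin_cases r <;> simp [theta, theta1_neg, theta2_neg, theta3_neg, theta4_neg, neg_div_neg_eq]

lemma perm_one_perm_one (r : Fin 4) : perm 1 (perm 1 r) = r := by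
  revert r; decide

lemma perm_perm_one (r s : Fin 4) : perm (perm 1 r) s = perm 1 (perm r s) := by
  revert r s; decide

namespace Parameters

variable (P : Parameters)

lemma swap_swap : P.swap.swap = P := by
  have h : (perm 1 : Fin 4 → Fin 4) ∘ perm 1 = id := funext perm_one_perm_one
  obtain ⟨M, p, u, v, w⟩ := P
  simp [swap, Function.comp_assoc, h]

lemma perm_one_zero : perm 1 0 = 1 := by decide

lemma perm_one_one : perm 1 1 = 0 := by decide

lemma swap_u_zero : P.swap.u 0 = P.u 1 := by simp [swap, perm_one_zero]

lemma swap_u_one : P.swap.u 1 = P.u 0 := by simp [swap, perm_one_one]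

lemma swap_v_zero : P.swap.v 0 = P.v 1 := by simp [swap, perm_one_zero]

lemma swap_v_one : P.swap.v 1 = P.v 0 := by simp [swap, perm_one_one]

lemma swap_M : P.swap.M = P.M := rfl

lemma swap_p : P.swap.p = P.p := rfl

lemma swap_alpha : P.swap.alpha = P.alpha := by
  simp only [alpha, swap_u_zero, swap_u_one, swap_M]
  rw [add_comm (P.u 1)]

lemma swap_bracket (r : Fin 4) (z : ℝ) : P.swap.bracket r z = P.bracket r z := by
  simp only [bracket, swap_alpha, swap_p]

lemma pi_div_alpha : Real.pi / P.alpha = P.u 0 + P.u 1 + P.M := by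
  rw [alpha, div_div_cancel₀ Real.pi_ne_zero]

lemma swap_coeffC_perm_one (r : Fin 4) : P.swap.coeffC (perm 1 r) = P.coeffC r := by
  simp only [coeffC, swap_bracket]
  simp only [swap, Function.comp, perm_perm_one, perm_one_perm_one]

/-- The admissible parameter domain, apart from the virtual parameter. -/
structure Admissible : Prop where
  p_pos : 0 < P.p
  p_lt_one : P.p < 1
  u_zero_pos : 0 < P.u 0
  u_one_pos : 0 < P.u 1
  v_zero : |P.v 0| < P.u 0 + 1 / 2
  v_one : |P.v 1| < P.u 1 + 1 / 2

variable {P}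

namespace Admissible

variable (hP : P.Admissible)
include hP

lemma swap : P.swap.Admissible where
  p_pos := hP.p_pos
  p_lt_one := hP.p_lt_one
  u_zero_pos := by rw [swap_u_zero]; exact hP.u_one_pos
  u_one_pos := by rw [swap_u_one]; exact hP.u_zero_pos
  v_zero := by rw [swap_u_zero, swap_v_zero]; exact hP.v_one
  v_one := by rw [swap_u_one, swap_v_one]; exact hP.v_zero

lemma period_pos : 0 < P.u 0 + P.u 1 + P.M := by
  have := hP.u_zero_pos
  have := hP.u_one_pos
  positivity

lemma alpha_pos : 0 < P.alpha := div_pos Real.pi_pos hP.period_pos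

lemma alpha_mul_period : P.alpha * (P.u 0 + P.u 1 + P.M) = Real.pi :=
  div_mul_cancel₀ _ hP.period_pos.ne'

/-- Each bracket is a rescaled theta function, up to a positive normalization. -/
lemma exists_bracket_eq (r : Fin 4) :
    ∃ c : ℝ, 0 < c ∧ ∀ z, P.bracket r z = theta P.p r (P.alpha / 2 * z) / c := by
  have hα := hP.alpha_pos
  have h1 := deriv_theta1_zero_pos hP.p_pos hP.p_lt_one
  have h2 := theta2_pos hP.p_pos hP.p_lt_one (z := 0) (by linarith [Real.pi_pos])
    (by linarith [Real.pi_pos])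
  have h3 := theta3_pos hP.p_pos hP.p_lt_one 0
  have h4 := theta4_pos hP.p_pos hP.p_lt_one 0
  fin_cases r
  · exact ⟨P.alpha / 2 * deriv (theta1 P.p) 0, by positivity, fun z => rfl⟩
  · exact ⟨_, h2, fun z => rfl⟩
  · exact ⟨_, h3, fun z => rfl⟩
  · exact ⟨_, h4, fun z => rfl⟩

lemma bracket_div_bracket (r : Fin 4) (x y : ℝ) : P.bracket r x / P.bracket r y =
    theta P.p r (P.alpha / 2 * x) / theta P.p r (P.alpha / 2 * y) := by
  obtain ⟨c, hc, h⟩ := hP.exists_bracket_eq r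
  rw [h, h, div_div_div_cancel_right₀ hc.ne']

lemma bracket_div_bracket_neg (r : Fin 4) (x y : ℝ) :
    P.bracket r (-x) / P.bracket r (-y) = P.bracket r x / P.bracket r y := by
  rw [hP.bracket_div_bracket, hP.bracket_div_bracket, mul_neg, mul_neg, theta_div_theta_neg]

lemma bracket_div_bracket_add_half_period (r : Fin 4) (x y : ℝ) :
    P.bracket r (x + Real.pi / P.alpha) / P.bracket r (y + Real.pi / P.alpha) =
      P.bracket (perm 1 r) x / P.bracket (perm 1 r) y := by
  have h : ∀ z, P.alpha / 2 * (z + Real.pi / P.alpha) = P.alpha / 2 * z + Real.pi / 2 := by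
    intro z
    have := hP.alpha_pos.ne'
    field_simp
  rw [hP.bracket_div_bracket, hP.bracket_div_bracket, h, h, theta_div_theta_add_pi_div_two]

lemma coeffA_add_half_period (z : ℝ) :
    P.coeffA (z + Real.pi / P.alpha) = P.swap.coeffA z := by
  unfold coeffA
  rw [← Equiv.prod_comp (perm 1) fun r => P.swap.bracket r (z + P.swap.u r) / _ * _]
  refine Finset.prod_congr rfl fun r _ => ?_
  rw [show z + Real.pi / P.alpha + P.u r = z + P.u r + Real.pi / P.alpha by ring,
    show z + Real.pi / P.alpha + 1 / 2 + P.v r = z + 1 / 2 + P.v r + Real.pi / P.alpha by ring,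
    show z + Real.pi / P.alpha + 1 / 2 = z + 1 / 2 + Real.pi / P.alpha by ring,
    hP.bracket_div_bracket_add_half_period, hP.bracket_div_bracket_add_half_period]
  simp only [swap_bracket]
  simp only [Parameters.swap, Function.comp, perm_one_perm_one]

lemma coeffB_add_half_period (z : ℝ) :
    P.coeffB (z + Real.pi / P.alpha) = P.swap.coeffB z := by
  unfold coeffB
  rw [← Equiv.sum_comp (perm 1) fun r => P.swap.coeffC r * _ * _]
  refine Finset.sum_congr rfl fun r _ => ?_
  rw [show z + Real.pi / P.alpha + 1 / 2 + P.w = z + 1 / 2 + P.w + Real.pi / P.alpha by ring,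
    show z + Real.pi / P.alpha - 1 / 2 - P.w = z - 1 / 2 - P.w + Real.pi / P.alpha by ring,
    show z + Real.pi / P.alpha + 1 / 2 = z + 1 / 2 + Real.pi / P.alpha by ring,
    show z + Real.pi / P.alpha - 1 / 2 = z - 1 / 2 + Real.pi / P.alpha by ring,
    hP.bracket_div_bracket_add_half_period, hP.bracket_div_bracket_add_half_period,
    swap_coeffC_perm_one]
  simp only [swap_bracket]
  rfl

lemma coeffB_neg (z : ℝ) : P.coeffB (-z) = P.coeffB z := by
  unfold coeffB
  refine Finset.sum_congr rfl fun r _ => ?_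
  rw [show -z + 1 / 2 + P.w = -(z - 1 / 2 - P.w) by ring,
    show -z - 1 / 2 - P.w = -(z + 1 / 2 + P.w) by ring,
    show -z + 1 / 2 = -(z - 1 / 2) by ring, show -z - 1 / 2 = -(z + 1 / 2) by ring,
    hP.bracket_div_bracket_neg, hP.bracket_div_bracket_neg]
  ring

lemma aTilde_eq_swap_a (k : ℕ) : P.aTilde k = P.swap.a k := by
  rw [aTilde, Parameters.a, ← hP.coeffA_add_half_period, pi_div_alpha, swap_u_zero]
  congr 1
  ring

lemma swap_aTilde (k : ℕ) : P.swap.aTilde k = P.a k := by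
  rw [hP.swap.aTilde_eq_swap_a, swap_swap]

lemma swap_b {i j : ℕ} (h : i + j = P.M) : P.swap.b i = P.b j := by
  have hM : (P.M : ℝ) = i + j := by exact_mod_cast h.symm
  rw [Parameters.b, Parameters.b, ← hP.swap.coeffB_neg, ← hP.coeffB_add_half_period,
    pi_div_alpha, swap_u_zero, hM]
  congr 1
  ring

lemma a_eq_prod (k : ℕ) : P.a k = ∏ r : Fin 4,
    P.bracket r (P.u 0 - P.u r + k) / P.bracket r (P.u 0 + k) *
      (P.bracket r (P.u 0 - P.v r - 1 / 2 + k) / P.bracket r (P.u 0 - 1 / 2 + k)) := by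
  unfold a coeffA
  refine Finset.prod_congr rfl fun r _ => ?_
  rw [show -P.u 0 - k + P.u r = -(P.u 0 - P.u r + k) by ring,
    show -P.u 0 - k + 1 / 2 + P.v r = -(P.u 0 - P.v r - 1 / 2 + k) by ring,
    show -P.u 0 - k = -(P.u 0 + (k : ℝ)) by ring,
    show -(P.u 0 + (k : ℝ)) + 1 / 2 = -(P.u 0 - 1 / 2 + k) by ring,
    hP.bracket_div_bracket_neg, hP.bracket_div_bracket_neg]

lemma bracket_pos_of_theta_pos {r : Fin 4} {z : ℝ} (h : 0 < theta P.p r (P.alpha / 2 * z)) :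
    0 < P.bracket r z := by
  obtain ⟨c, hc, hb⟩ := hP.exists_bracket_eq r
  rw [hb]
  exact div_pos h hc

lemma bracket_zero_pos {z : ℝ} (h0 : 0 < z) (h1 : z < 2 * (P.u 0 + P.u 1 + P.M)) :
    0 < P.bracket 0 z := by
  have hα := hP.alpha_pos
  have := hP.alpha_mul_period
  exact hP.bracket_pos_of_theta_pos
    (theta1_pos hP.p_pos hP.p_lt_one (by positivity) (by nlinarith))

lemma bracket_one_pos {z : ℝ} (h0 : -(P.u 0 + P.u 1 + P.M) < z) (h1 : z < P.u 0 + P.u 1 + P.M) :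
    0 < P.bracket 1 z := by
  have hα := hP.alpha_pos
  have := hP.alpha_mul_period
  exact hP.bracket_pos_of_theta_pos
    (theta2_pos hP.p_pos hP.p_lt_one (by nlinarith) (by nlinarith))

lemma bracket_two_pos (z : ℝ) : 0 < P.bracket 2 z :=
  hP.bracket_pos_of_theta_pos (theta3_pos hP.p_pos hP.p_lt_one _)

lemma bracket_three_pos (z : ℝ) : 0 < P.bracket 3 z :=
  hP.bracket_pos_of_theta_pos (theta4_pos hP.p_pos hP.p_lt_one _)

lemma a_pos {k : ℕ} (hk : k ∈ Finset.Icc 1 P.M) : 0 < P.a k := by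
  obtain ⟨hk1, hkM⟩ := Finset.mem_Icc.mp hk
  have h1 : (1 : ℝ) ≤ k := by exact_mod_cast hk1
  have hM : (k : ℝ) ≤ P.M := by exact_mod_cast hkM
  have hu0 := hP.u_zero_pos
  have hu1 := hP.u_one_pos
  obtain ⟨hv1, hv2⟩ := abs_lt.mp hP.v_zero
  obtain ⟨hv3, hv4⟩ := abs_lt.mp hP.v_one
  rw [hP.a_eq_prod]
  refine Finset.prod_pos fun r _ => ?_
  suffices h : 0 < P.bracket r (P.u 0 - P.u r + k) ∧ 0 < P.bracket r (P.u 0 + k) ∧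
      0 < P.bracket r (P.u 0 - P.v r - 1 / 2 + k) ∧ 0 < P.bracket r (P.u 0 - 1 / 2 + k) by
    obtain ⟨h1, h2, h3, h4⟩ := h
    positivity
  match r with
  | 0 => refine ⟨?_, ?_, ?_, ?_⟩ <;> apply hP.bracket_zero_pos <;> linarith
  | 1 => refine ⟨?_, ?_, ?_, ?_⟩ <;> apply hP.bracket_one_pos <;> linarith
  | 2 => exact ⟨hP.bracket_two_pos _, hP.bracket_two_pos _, hP.bracket_two_pos _,
      hP.bracket_two_pos _⟩
  | 3 => exact ⟨hP.bracket_three_pos _, hP.bracket_three_pos _, hP.bracket_three_pos _,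
      hP.bracket_three_pos _⟩

lemma aTilde_pos {k : ℕ} (hk : k ∈ Finset.Icc 1 P.M) : 0 < P.aTilde k := by
  rw [hP.aTilde_eq_swap_a]
  exact hP.swap.a_pos hk

lemma inv_a_eq_prod (k : ℕ) : (P.a k)⁻¹ = ∏ r : Fin 4,
    P.bracket r (P.u 0 + k) / P.bracket r (P.u 0 - P.u r + k) *
      (P.bracket r (P.u 0 - 1 / 2 + k) / P.bracket r (P.u 0 - P.v r - 1 / 2 + k)) := by
  rw [hP.a_eq_prod, ← Finset.prod_inv_distrib]
  refine Finset.prod_congr rfl fun r _ => ?_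
  rw [mul_inv, inv_div, inv_div]

end Admissible
end Parameters

section Continuant

variable {R : Type*} [CommRing R]

/-- The tridiagonal matrix with diagonal `d`, lower diagonal `l` and upper diagonal `u`; the rows
index the three sequences. -/
def tridiagonal (d l u : ℕ → R) (n : ℕ) : Matrix (Fin n) (Fin n) R :=
  Matrix.of fun i j =>
    if (i : ℕ) = j then d i else if (i : ℕ) = j + 1 then l i else if (j : ℕ) = i + 1 then u i else 0

/-- The continuant of a diagonal `d` and products `β` of opposite off-diagonal entries. -/
def continuant (d β : ℕ → R) : ℕ → R
  | 0 => 1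
  | 1 => d 0
  | n + 2 => d (n + 1) * continuant d β (n + 1) - β n * continuant d β n

lemma continuant_succ_succ (d β : ℕ → R) (n : ℕ) : continuant d β (n + 2) =
    d (n + 1) * continuant d β (n + 1) - β n * continuant d β n := by
  rw [continuant]

lemma continuant_congr {d d' β β' : ℕ → R} (n : ℕ) (hd : ∀ i, i < n → d i = d' i)
    (hβ : ∀ i, i + 1 < n → β i = β' i) : continuant d β n = continuant d' β' n := by
  induction n using Nat.twoStepInduction with
  | zero => rfl
  | one => exact hd 0 one_pos
  | more n h0 h1 =>
    rw [continuant_succ_succ, continuant_succ_succ, hd (n + 1) (by lia), hβ n (by lia),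
      h1 (fun i hi => hd i (by lia)) (fun i hi => hβ i (by lia)),
      h0 (fun i hi => hd i (by lia)) (fun i hi => hβ i (by lia))]

lemma map_continuant {S : Type*} [CommRing S] (φ : R →+* S) (d β : ℕ → R) (n : ℕ) :
    φ (continuant d β n) = continuant (fun i => φ (d i)) (fun i => φ (β i)) n := by
  induction n using Nat.twoStepInduction with
  | zero => simp [continuant]
  | one => simp [continuant]
  | more n h0 h1 => simp only [continuant_succ_succ, map_sub, map_mul, h0, h1]

lemma det_tridiagonal_succ_succ (d l u : ℕ → R) (n : ℕ) :
    (tridiagonal d l u (n + 2)).det = d (n + 1) * (tridiagonal d l u (n + 1)).det -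
      u n * l (n + 1) * (tridiagonal d l u n).det := by
  rw [Matrix.det_succ_row _ (Fin.last (n + 1)), Fin.sum_univ_castSucc, Fin.sum_univ_castSucc,
    Finset.sum_eq_zero]
  · have h1 : ((tridiagonal d l u (n + 2)).submatrix (Fin.last (n + 1)).succAbove
        (Fin.last (n + 1)).succAbove) = tridiagonal d l u (n + 1) := by
      ext i j
      simp [tridiagonal]
    have h2 : ((tridiagonal d l u (n + 2)).submatrix (Fin.last (n + 1)).succAbove
        (Fin.last n).castSucc.succAbove).det = u n * (tridiagonal d l u n).det := by
      rw [Matrix.det_succ_column _ (Fin.last n), Fin.sum_univ_castSucc, Finset.sum_eq_zero]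
      · have h3 : (((tridiagonal d l u (n + 2)).submatrix (Fin.last (n + 1)).succAbove
            (Fin.last n).castSucc.succAbove).submatrix (Fin.last n).succAbove
            (Fin.last n).succAbove) = tridiagonal d l u n := by
          ext i j
          have hj : (Fin.last n).castSucc.succAbove j.castSucc = j.castSucc.castSucc :=
            Fin.succAbove_of_castSucc_lt _ _ (by simp [Fin.lt_def])
          simp [tridiagonal, hj]
        have hu : n ≠ n + 1 + 1 := by lia
        rw [h3, ← two_mul, pow_mul]
        simp [tridiagonal, hu]
      · intro i _
        have hi : (i : ℕ) < n := i.2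
        have : (tridiagonal d l u (n + 2)).submatrix (Fin.last (n + 1)).succAbove
            (Fin.last n).castSucc.succAbove i.castSucc (Fin.last n) = 0 := by
          simp only [tridiagonal, Matrix.submatrix_apply, Matrix.of_apply, Fin.succAbove_last,
            Fin.succAbove_castSucc_self, Fin.val_castSucc, Fin.val_succ, Fin.val_last]
          rw [if_neg (by lia), if_neg (by lia), if_neg (by lia)]
        rw [this]
        ring
    rw [h1, h2]
    have hn : (-1 : R) ^ (n + 1 + n) = -1 := by
      rw [show n + 1 + n = 2 * n + 1 by ring, pow_succ, pow_mul]
      simp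
    simp [tridiagonal, ← two_mul, pow_mul, hn]
    ring
  · intro j _
    have hj : (j : ℕ) < n := j.2
    have : tridiagonal d l u (n + 2) (Fin.last (n + 1)) j.castSucc.castSucc = 0 := by
      simp only [tridiagonal, Matrix.of_apply, Fin.val_castSucc, Fin.val_last]
      rw [if_neg (by lia), if_neg (by lia), if_neg (by lia)]
    rw [this]
    ring

lemma det_tridiagonal (d l u : ℕ → R) (n : ℕ) :
    (tridiagonal d l u n).det = continuant d (fun i => u i * l (i + 1)) n := by
  induction n using Nat.twoStepInduction with
  | zero => simp [continuant]
  | one => simp [continuant, tridiagonal]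
  | more n h0 h1 => rw [det_tridiagonal_succ_succ, continuant_succ_succ, h0, h1]

/-- A continuant of order `M + 1` does not change when its data are reversed. -/
lemma continuant_reverse {d d' β β' : ℕ → R} {M : ℕ} (hd : ∀ i j, i + j = M → d' i = d j)
    (hβ : ∀ i j, i + j + 1 = M → β' i = β j) :
    continuant d' β' (M + 1) = continuant d β (M + 1) := by
  have key : ∀ k m, k + m + 1 = M → continuant d β (k + 1) * continuant d' β' (m + 1) -
      β k * continuant d β k * continuant d' β' m = continuant d' β' (M + 1) := by
    intro k
    induction k with
    | zero =>
      intro m hm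
      obtain rfl : M = m + 1 := by lia
      rw [continuant_succ_succ, hd (m + 1) 0 (by lia), hβ m 0 (by lia)]
      simp only [continuant]
      ring
    | succ k ih =>
      intro m hm
      rw [← ih (m + 1) (by lia), continuant_succ_succ d' β' m, hd (m + 1) (k + 1) (by lia),
        hβ m (k + 1) (by lia), continuant_succ_succ d β k]
      ring
  rcases M with _ | M
  · exact hd 0 0 rfl
  · rw [← key M 0 (by lia), continuant_succ_succ d β M]
    simp only [continuant, hd 0 (M + 1) (by lia)]
    ring

/-- If a continuant of order `M + 1` vanishes, then its leading and trailing continuants are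
proportional. -/
lemma continuant_mul_reverse {d d' β β' : ℕ → R} {M : ℕ} (hd : ∀ i j, i + j = M → d' i = d j)
    (hβ : ∀ i j, i + j + 1 = M → β' i = β j) (h : continuant d' β' (M + 1) = 0) :
    ∀ k m, k + m = M → continuant d β k * continuant d' β' M =
      (∏ i ∈ Finset.range k, β i) * continuant d' β' m := by
  intro k
  induction k using Nat.twoStepInduction with
  | zero =>
    rintro m rfl
    simp [continuant]
  | one =>
    intro m hm
    obtain rfl : M = m + 1 := by lia
    rw [continuant_succ_succ, hd (m + 1) 0 (by lia), hβ m 0 (by lia)] at h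
    simp only [continuant, Finset.prod_range_one]
    linear_combination h
  | more k h0 h1 =>
    intro m hm
    have e0 := h0 (m + 2) (by lia)
    have e1 := h1 (m + 1) (by lia)
    rw [continuant_succ_succ d' β' m, hd (m + 1) (k + 1) (by lia),
      hβ m (k + 1) (by lia)] at e0
    rw [continuant_succ_succ d β k, Finset.prod_range_succ, Finset.prod_range_succ]
    rw [Finset.prod_range_succ] at e1
    linear_combination d (k + 1) * e1 - β k * e0

end Continuant

section OrthogonalPolynomials

open Polynomial

/-- The monic polynomials with recurrence coefficients `d` and `β`. -/
noncomputable def orthPoly (d β : ℕ → ℝ) (n : ℕ) : ℝ[X] :=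
  continuant (fun i => X - C (d i)) (fun i => C (β i)) n

lemma charpoly_tridiagonal (d l u : ℕ → ℝ) (n : ℕ) :
    (tridiagonal d l u n).charpoly = orthPoly d (fun i => u i * l (i + 1)) n := by
  have h : (tridiagonal d l u n).charmatrix =
      tridiagonal (fun i => X - C (d i)) (fun i => -C (l i)) (fun i => -C (u i)) n := by
    ext1 i j
    by_cases hij : i = j
    · subst hij
      simp [tridiagonal]
    · have hv : (i : ℕ) ≠ j := fun h => hij (Fin.ext h)
      rw [Matrix.charmatrix_apply_ne _ _ _ hij]
      simp only [tridiagonal, Matrix.of_apply, if_neg hv]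
      split_ifs <;> simp
  rw [Matrix.charpoly, h, det_tridiagonal, orthPoly]
  simp only [neg_mul_neg, ← C_mul]

lemma eval_orthPoly (d β : ℕ → ℝ) (n : ℕ) (x : ℝ) :
    (orthPoly d β n).eval x = continuant (fun i => x - d i) β n := by
  rw [orthPoly, ← coe_evalRingHom, map_continuant]
  simp

lemma orthPoly_zero (d β : ℕ → ℝ) : orthPoly d β 0 = 1 := rfl

lemma orthPoly_one (d β : ℕ → ℝ) : orthPoly d β 1 = X - C (d 0) := rfl

lemma orthPoly_succ_succ (d β : ℕ → ℝ) (n : ℕ) : orthPoly d β (n + 2) =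
    (X - C (d (n + 1))) * orthPoly d β (n + 1) - C (β n) * orthPoly d β n :=
  continuant_succ_succ _ _ n

/-- The Christoffel–Darboux formula. -/
lemma christoffel_darboux (d β : ℕ → ℝ) (x y : ℝ) (n : ℕ) (hβ : ∀ i < n, β i ≠ 0) :
    (x - y) * ∑ k ∈ Finset.range (n + 1), (orthPoly d β k).eval x * (orthPoly d β k).eval y /
      ∏ i ∈ Finset.range k, β i =
    ((orthPoly d β (n + 1)).eval x * (orthPoly d β n).eval y -
      (orthPoly d β n).eval x * (orthPoly d β (n + 1)).eval y) /
      ∏ i ∈ Finset.range n, β i := by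
  induction n with
  | zero => simp [orthPoly_zero, orthPoly_one]
  | succ n ih =>
    have h0 : ∏ i ∈ Finset.range n, β i ≠ 0 :=
      Finset.prod_ne_zero_iff.mpr fun i hi => hβ i (by have := Finset.mem_range.mp hi; lia)
    have h1 := hβ n (by lia)
    rw [Finset.sum_range_succ, mul_add, ih fun i hi => hβ i (by lia), orthPoly_succ_succ,
      Finset.prod_range_succ]
    simp only [eval_sub, eval_mul, eval_X, eval_C]
    field_simp
    ring

/-- The confluent Christoffel–Darboux formula. -/
lemma christoffel_darboux_confluent (d β : ℕ → ℝ) (x : ℝ) (n : ℕ) (hβ : ∀ i < n, β i ≠ 0) :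
    ∑ k ∈ Finset.range (n + 1), (orthPoly d β k).eval x ^ 2 / ∏ i ∈ Finset.range k, β i =
    ((orthPoly d β (n + 1)).derivative.eval x * (orthPoly d β n).eval x -
      (orthPoly d β n).derivative.eval x * (orthPoly d β (n + 1)).eval x) /
      ∏ i ∈ Finset.range n, β i := by
  induction n with
  | zero => simp [orthPoly_zero, orthPoly_one]
  | succ n ih =>
    have h0 : ∏ i ∈ Finset.range n, β i ≠ 0 :=
      Finset.prod_ne_zero_iff.mpr fun i hi => hβ i (by have := Finset.mem_range.mp hi; lia)
    have h1 := hβ n (by lia)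
    rw [Finset.sum_range_succ, ih fun i hi => hβ i (by lia), orthPoly_succ_succ,
      Finset.prod_range_succ]
    simp only [derivative_sub, derivative_mul, derivative_X, derivative_C, eval_sub, eval_mul,
      eval_add, eval_X, eval_C, eval_zero, eval_one]
    field_simp
    ring

lemma sum_sq_div_pos (d β : ℕ → ℝ) (x : ℝ) (n : ℕ) (hβ : ∀ i < n, 0 < β i) :
    0 < ∑ k ∈ Finset.range (n + 1),
      (orthPoly d β k).eval x ^ 2 / ∏ i ∈ Finset.range k, β i := by
  have hp : ∀ k ∈ Finset.range (n + 1), 0 < ∏ i ∈ Finset.range k, β i := fun k hk =>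
    Finset.prod_pos fun i hi => hβ i (by
      have := Finset.mem_range.mp hi
      have := Finset.mem_range.mp hk
      lia)
  refine Finset.sum_pos' (fun k hk => div_nonneg (sq_nonneg _) (hp k hk).le)
    ⟨0, by simp, by simp [orthPoly_zero]⟩

lemma splits_orthPoly (d β : ℕ → ℝ) (n : ℕ) (hβ : ∀ i, i + 1 < n → 0 ≤ β i) :
    (orthPoly d β n).Splits := by
  let s : ℕ → ℝ := fun i => √(β i)
  have hs : orthPoly d β n = (tridiagonal d (fun i => s (i - 1)) s n).charpoly := by
    rw [charpoly_tridiagonal]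
    refine continuant_congr n (fun _ _ => rfl) fun i hi => ?_
    simp [s, Real.mul_self_sqrt (hβ i hi)]
  rw [hs]
  refine Matrix.IsHermitian.splits_charpoly (Matrix.IsHermitian.ext fun i j => ?_)
  simp only [tridiagonal, Matrix.of_apply, star_trivial]
  by_cases h1 : (i : ℕ) = j
  · simp [h1]
  by_cases h2 : (i : ℕ) = j + 1
  · have h : (j : ℕ) ≠ j + 1 + 1 := by lia
    simp [h2, h]
  by_cases h3 : (j : ℕ) = i + 1
  · have h : (i : ℕ) ≠ i + 1 + 1 := by lia
    simp [h3, h]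
  simp [h1, h2, h3, Ne.symm h1]

lemma monic_natDegree_orthPoly (d β : ℕ → ℝ) (n : ℕ) :
    (orthPoly d β n).Monic ∧ (orthPoly d β n).natDegree = n := by
  have h : orthPoly d β n = (tridiagonal d (fun _ => 1) β n).charpoly := by
    rw [charpoly_tridiagonal]
    simp
  rw [h, Matrix.charpoly_natDegree_eq_dim, Fintype.card_fin]
  exact ⟨Matrix.charpoly_monic _, rfl⟩

/-- The roots of an orthogonal polynomial are real and simple. -/
lemma exists_strictAnti_roots (d β : ℕ → ℝ) (n : ℕ) (hβ : ∀ i < n, 0 < β i) :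
    ∃ E : Fin (n + 1) → ℝ, StrictAnti E ∧ orthPoly d β (n + 1) = ∏ j, (X - C (E j)) := by
  obtain ⟨hm, hdeg⟩ := monic_natDegree_orthPoly d β (n + 1)
  have hsp := splits_orthPoly d β (n + 1) fun i hi => (hβ i (by lia)).le
  have hnd : (orthPoly d β (n + 1)).roots.Nodup := by
    rw [Multiset.nodup_iff_count_le_one]
    intro x
    rw [count_roots]
    by_contra! hlt
    obtain ⟨h0, h1⟩ := (one_lt_rootMultiplicity_iff_isRoot hm.ne_zero).mp hlt
    have hs := sum_sq_div_pos d β x n hβ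
    rw [christoffel_darboux_confluent d β x n fun i hi => (hβ i hi).ne', h0.eq_zero,
      h1.eq_zero] at hs
    simp at hs
  have hcard : (orthPoly d β (n + 1)).roots.toFinset.card = n + 1 := by
    rw [Multiset.toFinset_card_of_nodup hnd, ← hsp.natDegree_eq_card_roots, hdeg]
  let e := Finset.orderEmbOfFin _ hcard
  refine ⟨fun j => e j.rev, fun i j hij => e.strictMono (Fin.rev_lt_rev.mpr hij), ?_⟩
  conv_lhs => rw [hsp.eq_prod_roots_of_monic hm]
  have h1 : ∏ j : Fin (n + 1), (X - C (e j.rev)) = ∏ j, (X - C (e j)) :=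
    Equiv.prod_comp Fin.revPerm fun j => X - C (e j)
  have h2 : ∏ j, (X - C (e j)) =
      ∏ x ∈ (orthPoly d β (n + 1)).roots.toFinset, (X - C x) := by
    rw [← Finset.image_orderEmbOfFin_univ _ hcard,
      Finset.prod_image fun a _ b _ h => e.injective h]
  rw [h1, h2, Finset.prod_multiset_map_count]
  refine (Finset.prod_congr rfl fun x hx => ?_)
  rw [Multiset.count_eq_one_of_mem hnd (Multiset.mem_toFinset.mp hx), pow_one]

lemma eval_derivative_prod_X_sub_C {ι : Type*} [Fintype ι] [DecidableEq ι] (E : ι → ℝ) (j : ι) :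
    (∏ i, (X - C (E i))).derivative.eval (E j) = ∏ l ∈ Finset.univ.erase j, (E j - E l) := by
  rw [derivative_prod_finset, eval_finsetSum, Finset.sum_eq_single j]
  · simp [eval_prod]
  · intro i _ hi
    have : ∏ l ∈ Finset.univ.erase i, (E j - E l) = 0 :=
      Finset.prod_eq_zero (Finset.mem_erase.mpr ⟨hi.symm, Finset.mem_univ j⟩) (sub_self _)
    simp [eval_prod, this]
  · simp

end OrthogonalPolynomials
namespace Parameters

variable (P : Parameters)

/-- The recurrence coefficients `a_{i+1} ã_{M-i}`. -/
noncomputable def offDiag (i : ℕ) : ℝ := P.a (i + 1) * P.aTilde (P.M - i)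

lemma racahPoly_eq_orthPoly (n : ℕ) : P.racahPoly n = orthPoly P.b P.offDiag n := by
  have h : P.heunBlock n = tridiagonal P.b P.a (fun i => P.aTilde (P.M - i)) n := rfl
  rw [racahPoly, h, charpoly_tridiagonal]
  congr 1
  exact funext fun i => mul_comm _ _

lemma prod_Icc_one_eq_prod_range (g : ℕ → ℝ) (n : ℕ) :
    ∏ k ∈ Finset.Icc 1 n, g k = ∏ k ∈ Finset.range n, g (k + 1) := by
  rw [← Finset.Ico_add_one_right_eq_Icc, Finset.prod_Ico_eq_prod_range]
  simp [add_comm]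

lemma weight_eq_prod_range (k : ℕ) :
    P.weight k = ∏ i ∈ Finset.range k, P.aTilde (P.M - i) / P.a (i + 1) := by
  rw [weight, prod_Icc_one_eq_prod_range fun l => P.aTilde (P.M + 1 - l) / P.a l]
  simp [Nat.add_sub_add_right]

variable {P}

namespace Admissible

lemma a_succ_pos (hP : P.Admissible) {i : ℕ} (hi : i < P.M) : 0 < P.a (i + 1) :=
  hP.a_pos (Finset.mem_Icc.mpr (by lia))

lemma aTilde_sub_pos (hP : P.Admissible) {i : ℕ} (hi : i < P.M) : 0 < P.aTilde (P.M - i) :=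
  hP.aTilde_pos (Finset.mem_Icc.mpr (by lia))

lemma offDiag_pos (hP : P.Admissible) {i : ℕ} (hi : i < P.M) : 0 < P.offDiag i :=
  mul_pos (hP.a_succ_pos hi) (hP.aTilde_sub_pos hi)

lemma prod_a_pos (hP : P.Admissible) : 0 < ∏ k ∈ Finset.Icc 1 P.M, P.a k :=
  Finset.prod_pos fun _ hk => hP.a_pos hk

lemma swap_offDiag (hP : P.Admissible) {i j : ℕ} (h : i + j + 1 = P.M) :
    P.swap.offDiag i = P.offDiag j := by
  rw [offDiag, offDiag, swap_M, hP.swap_aTilde, ← hP.aTilde_eq_swap_a, mul_comm,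
    show P.M - i = j + 1 by lia, show P.M - j = i + 1 by lia]

lemma f_mul_f_mul_weight (hP : P.Admissible) (x y : ℝ) {k : ℕ} (hk : k ≤ P.M) :
    P.f k x * P.f k y * P.weight k =
      (P.racahPoly k).eval x * (P.racahPoly k).eval y / ∏ i ∈ Finset.range k, P.offDiag i := by
  have hw : (∏ i ∈ Finset.range k, (P.aTilde (P.M - i))⁻¹) ^ 2 * P.weight k =
      (∏ i ∈ Finset.range k, P.offDiag i)⁻¹ := by
    rw [weight_eq_prod_range, ← Finset.prod_pow, ← Finset.prod_mul_distrib,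
      ← Finset.prod_inv_distrib]
    refine Finset.prod_congr rfl fun i hi => ?_
    have hi' : i < P.M := (Finset.mem_range.mp hi).trans_le hk
    have h1 := (hP.a_succ_pos hi').ne'
    have h2 := (hP.aTilde_sub_pos hi').ne'
    rw [offDiag]
    field_simp
  rw [f, f, div_eq_mul_inv, ← hw]
  ring

lemma sum_f_mul_f_mul_weight (hP : P.Admissible) (x y : ℝ) :
    ∑ k ∈ Finset.range (P.M + 1), P.f k x * P.f k y * P.weight k =
      ∑ k ∈ Finset.range (P.M + 1), (orthPoly P.b P.offDiag k).eval x *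
        (orthPoly P.b P.offDiag k).eval y / ∏ i ∈ Finset.range k, P.offDiag i := by
  refine Finset.sum_congr rfl fun k hk => ?_
  rw [hP.f_mul_f_mul_weight x y (Nat.lt_succ_iff.mp (Finset.mem_range.mp hk)),
    racahPoly_eq_orthPoly]

lemma racahPoly_mul_swap_racahPoly (hP : P.Admissible) {x : ℝ}
    (hx : (P.racahPoly (P.M + 1)).eval x = 0) :
    (P.racahPoly P.M).eval x * (P.swap.racahPoly P.M).eval x =
      ∏ i ∈ Finset.range P.M, P.offDiag i := by
  have hd : ∀ i j, i + j = P.M → x - P.swap.b i = x - P.b j := fun i j h => by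
    rw [hP.swap_b h]
  have hβ : ∀ i j, i + j + 1 = P.M → P.swap.offDiag i = P.offDiag j := fun i j h =>
    hP.swap_offDiag h
  rw [racahPoly_eq_orthPoly, eval_orthPoly] at hx
  have h := continuant_mul_reverse (d := fun i => x - P.b i) (d' := fun i => x - P.swap.b i)
    hd hβ ((continuant_reverse (d := fun i => x - P.b i) (d' := fun i => x - P.swap.b i)
      hd hβ).trans hx) P.M 0 (add_zero _)
  rw [racahPoly_eq_orthPoly, racahPoly_eq_orthPoly, eval_orthPoly, eval_orthPoly, h]
  simp [continuant]

end Admissible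
end Parameters
end EllipticRacah

theorem proposition3p4 (P : EllipticRacah.Parameters)
    (hp0 : 0 < P.p) (hp1 : P.p < 1)
    (hu1 : 0 < P.u 0) (hu2 : 0 < P.u 1)
    (hv1 : |P.v 0| < P.u 0 + 1 / 2) (hv2 : |P.v 1| < P.u 1 + 1 / 2)
    (hw : ∀ n : ℤ, P.w ≠ n * (2 * Real.pi / P.alpha))
    (hw1 : ∀ n : ℤ, P.w + 1 ≠ n * (2 * Real.pi / P.alpha)) :
    (∀ k ∈ Finset.Icc 1 P.M, 0 < P.a k ∧ 0 < P.aTilde k) ∧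
    ∃ E N : Fin (P.M + 1) → ℝ,
      StrictAnti E ∧ spectrum ℝ P.heunMatrix = Set.range E ∧
      (∀ j, P.eps (E j) ≠ 0) ∧
      (∀ i j, ∑ k ∈ Finset.range (P.M + 1), P.f k (E i) * P.f k (E j) * P.weight k =
        if i = j then N j else 0) ∧
      (∀ j, N j = 1 / (|P.eps (E j)| * ∏ k ∈ Finset.Icc 1 P.M, P.a k) *
        ∏ l ∈ Finset.univ.erase j, |E j - E l|) ∧
      (∀ j, N j = 1 / |P.eps (E j)| *
        (∏ k ∈ Finset.Icc 1 P.M, ∏ r : Fin 4,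
          P.bracket r (P.u 0 + k) / P.bracket r (P.u 0 - P.u r + k) *
          (P.bracket r (P.u 0 - 1 / 2 + k) / P.bracket r (P.u 0 - P.v r - 1 / 2 + k))) *
        ∏ l ∈ Finset.univ.erase j, |E j - E l|) := by
  have hP : P.Admissible := ⟨hp0, hp1, hu1, hu2, hv1, hv2⟩
  have hβ : ∀ i < P.M, 0 < P.offDiag i := fun i hi => hP.offDiag_pos hi
  have hβ' : ∀ i < P.M, P.offDiag i ≠ 0 := fun i hi => (hβ i hi).ne'
  have ha := hP.prod_a_pos
  have hprod : 0 < ∏ i ∈ Finset.range P.M, P.offDiag i :=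
    Finset.prod_pos fun i hi => hβ i (Finset.mem_range.mp hi)
  obtain ⟨E, hE, hfac⟩ := EllipticRacah.exists_strictAnti_roots P.b P.offDiag P.M hβ
  have hroot : ∀ j, (EllipticRacah.orthPoly P.b P.offDiag (P.M + 1)).eval (E j) = 0 := fun j => by
    rw [hfac, Polynomial.eval_prod]
    exact Finset.prod_eq_zero (Finset.mem_univ j) (by simp)
  have hmul : ∀ j, (P.racahPoly P.M).eval (E j) * (P.swap.racahPoly P.M).eval (E j) =
      ∏ i ∈ Finset.range P.M, P.offDiag i := fun j =>
    hP.racahPoly_mul_swap_racahPoly (by rw [P.racahPoly_eq_orthPoly, hroot])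
  have hq : ∀ j, (P.swap.racahPoly P.M).eval (E j) ≠ 0 := fun j h0 => by
    have := hmul j
    rw [h0, mul_zero] at this
    exact hprod.ne this
  have heps : ∀ j, |P.eps (E j)| * ∏ k ∈ Finset.Icc 1 P.M, P.a k =
      |(P.swap.racahPoly P.M).eval (E j)| := fun j => by
    rw [EllipticRacah.Parameters.eps, abs_div, abs_of_pos ha, div_mul_cancel₀ _ ha.ne']
  have hnorm : ∀ j, ∑ k ∈ Finset.range (P.M + 1), P.f k (E j) * P.f k (E j) * P.weight k =
      1 / (|P.eps (E j)| * ∏ k ∈ Finset.Icc 1 P.M, P.a k) *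
        ∏ l ∈ Finset.univ.erase j, |E j - E l| := fun j => by
    have hpos := EllipticRacah.sum_sq_div_pos P.b P.offDiag (E j) P.M hβ
    have hcd := EllipticRacah.christoffel_darboux_confluent P.b P.offDiag (E j) P.M hβ'
    have hval : ∑ k ∈ Finset.range (P.M + 1),
        (EllipticRacah.orthPoly P.b P.offDiag k).eval (E j) ^ 2 / ∏ i ∈ Finset.range k, P.offDiag i =
        (∏ l ∈ Finset.univ.erase j, (E j - E l)) / (P.swap.racahPoly P.M).eval (E j) := by
      rw [hcd, hroot, mul_zero, sub_zero, hfac, EllipticRacah.eval_derivative_prod_X_sub_C,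
        ← P.racahPoly_eq_orthPoly, div_eq_div_iff hprod.ne' (hq j), ← hmul j]
      ring
    rw [hP.sum_f_mul_f_mul_weight, heps]
    simp only [← sq]
    rw [← abs_of_pos hpos, hval, abs_div, Finset.abs_prod]
    ring
  refine ⟨fun k hk => ⟨hP.a_pos hk, hP.aTilde_pos hk⟩, E,
    fun j => 1 / (|P.eps (E j)| * ∏ k ∈ Finset.Icc 1 P.M, P.a k) *
        ∏ l ∈ Finset.univ.erase j, |E j - E l|, hE, ?_, fun j => div_ne_zero (hq j) ha.ne', ?_,
    fun j => rfl, fun j => ?_⟩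
  · ext x
    have h : P.heunMatrix.charpoly = ∏ j, (Polynomial.X - Polynomial.C (E j)) := by
      rw [← hfac, ← P.racahPoly_eq_orthPoly]
      rfl
    rw [Matrix.mem_spectrum_iff_isRoot_charpoly, h, Polynomial.IsRoot.def, Polynomial.eval_prod,
      Finset.prod_eq_zero_iff]
    simp [sub_eq_zero, eq_comm]
  · intro i j
    split_ifs with hij
    · rw [hij, hnorm]
    · have h := EllipticRacah.christoffel_darboux P.b P.offDiag (E i) (E j) P.M hβ'
      rw [hroot, hroot, zero_mul, mul_zero, sub_zero, zero_div] at h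
      rw [hP.sum_f_mul_f_mul_weight]
      exact (mul_eq_zero.mp h).resolve_left (sub_ne_zero.mpr (hE.injective.ne hij))
  · have h : ∏ k ∈ Finset.Icc 1 P.M, ∏ r : Fin 4,
        P.bracket r (P.u 0 + k) / P.bracket r (P.u 0 - P.u r + k) *
          (P.bracket r (P.u 0 - 1 / 2 + k) / P.bracket r (P.u 0 - P.v r - 1 / 2 + k)) =
        (∏ k ∈ Finset.Icc 1 P.M, P.a k)⁻¹ := by
      rw [← Finset.prod_inv_distrib]
      exact Finset.prod_congr rfl fun k _ => (hP.inv_a_eq_prod k).symm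
    rw [h]
    simp only [one_div, mul_inv]
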